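/- Let $G$ be a finitely generated group with word length $L$ with respect to a finite set $S = S^{-1}$ of generators, i.e. $L(g)$ is the least number of elements of $S$ whose product is $g$. Let $\sigma(n) = a_d n^d + \cdots + a_1 n + 1$ with $d \ge 1$, $a_1, \ldots, a_d \ge 0$ and $a_d > 0$ be a polynomial growth function. Let \[ \mathcal{A}_\sigma(G) = \Big\{ a = (a_g)_{g \in G} \in \mathbb{C}^G \;\Big|\; \|a\|_{L, \sigma, R} = \sum_{g \in G} |a_g|\, \sigma(L(g))^R < \infty \text{ for all real } R \ge 0 \Big\}, \] equipped with the locally convex topology defined by all the norms $\|\cdot\|_{L, \sigma, R}$, $R \ge 0$. Then $\mathcal{A}_\sigma(G)$ is nuclear if and only if $G$ has polynomial growth. Here a locally convex space $E$ is nuclear if for every continuous seminorm $p$ on $E$ there is a continuous seminorm $q \ge p$ such that the canonical map $\widehat{E}_q \to \widehat{E}_p$ between the Hausdorff completions of $(E, q)$ and $(E, p)$ is a nuclear map, i.e. of the form $x \mapsto \sum_{n} f_n(x)\, y_n$ with continuous functionals $f_n$ on $\widehat{E}_q$ and vectors $y_n \in \widehat{E}_p$ such that $\sum_n \|f_n\|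 \|y_n\| < \infty$. The group $G$ has polynomial growth if, for some finite symmetric generating set, there are constants $C, k$ such that at most $C (1+n)^k$ elements have word length at most $n$, for all $n \ge 0$. -/

import Mathlib

open scoped NNReal

noncomputable section

namespace RapidDecay

/-! ### Nuclear maps and nuclear locally convex spaces -/

section Nuclear

variable {𝕜 : Type*} [RCLike 𝕜]

/-- A continuous linear map `T : X → Y` is nuclear if `T x = ∑ₙ fₙ(x) yₙ` with continuous
functionals `fₙ` on `X` and vectors `yₙ` in `Y` such that `∑ₙ ‖fₙ‖ ‖yₙ‖ < ∞`.
(It is used below for maps between Banach spaces.) -/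
def IsNuclearMap {X Y : Type*} [SeminormedAddCommGroup X] [NormedSpace 𝕜 X]
    [SeminormedAddCommGroup Y] [NormedSpace 𝕜 Y] (T : X →L[𝕜] Y) : Prop :=
  ∃ (f : ℕ → X →L[𝕜] 𝕜) (y : ℕ → Y),
    Summable (fun n => ‖f n‖ * ‖y n‖) ∧ ∀ x, HasSum (fun n => f n x • y n) (T x)

variable {E : Type*} [AddCommGroup E] [Module 𝕜 E]

/-- The vector space `E`, considered as a seminormed space by means of the seminorm `p`. -/
def WithSeminorm (_p : Seminorm 𝕜 E) : Type _ := E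

namespace WithSeminorm

instance (p : Seminorm 𝕜 E) : AddCommGroup (WithSeminorm p) := inferInstanceAs (AddCommGroup E)

instance (p : Seminorm 𝕜 E) : Module 𝕜 (WithSeminorm p) := inferInstanceAs (Module 𝕜 E)

instance (p : Seminorm 𝕜 E) : Norm (WithSeminorm p) := ⟨fun x => p (show E from x)⟩

theorem core (p : Seminorm 𝕜 E) : SeminormedSpace.Core 𝕜 (WithSeminorm p) where
  norm_nonneg x := apply_nonneg p (show E from x)
  norm_smul c x := map_smul_eq_mul p c (show E from x)
  norm_triangle x y := map_add_le_add p (show E from x) (show E from y)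

instance (p : Seminorm 𝕜 E) : SeminormedAddCommGroup (WithSeminorm p) :=
  SeminormedAddCommGroup.ofCore (core p)

instance (p : Seminorm 𝕜 E) : NormedSpace 𝕜 (WithSeminorm p) where
  norm_smul_le c x := ((core p).norm_smul c x).le

/-- The identity of `E` as a linear map from `E` to `(E, p)`. -/
def of (p : Seminorm 𝕜 E) : E →ₗ[𝕜] WithSeminorm p where
  toFun x := x
  map_add' _ _ := rfl
  map_smul' _ _ := rfl

theorem norm_of (p : Seminorm 𝕜 E) (x : E) : ‖of p x‖ = p x := rfl

/-- For `p ≤ q`, the identity of `E` as a continuous linear map from `(E, q)` to `(E, p)`. -/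
def idMap {p q : Seminorm 𝕜 E} (h : p ≤ q) : WithSeminorm q →L[𝕜] WithSeminorm p :=
  LinearMap.mkContinuous
    ({ toFun := fun x => of p (show E from x)
       map_add' := fun _ _ => rfl
       map_smul' := fun _ _ => rfl } : WithSeminorm q →ₗ[𝕜] WithSeminorm p)
    1 (fun x => by rw [one_mul]; exact h (show E from x))

theorem idMap_of {p q : Seminorm 𝕜 E} (h : p ≤ q) (x : E) : idMap h (of q x) = of p x := rfl

end WithSeminorm

/-- The local Banach space of `E` at the seminorm `p`: the Hausdorff completion of `(E, p)`, that
is, the completion of the normed space `E ⧸ {x | p x = 0}`. -/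
abbrev LocalBanachSpace (p : Seminorm 𝕜 E) : Type _ :=
  UniformSpace.Completion (WithSeminorm p)

/-- For `p ≤ q`, the canonical map between the local Banach spaces of `E` at `q` and at `p`: the
continuous extension of the identity of `E`. -/
def canonicalMap {p q : Seminorm 𝕜 E} (h : p ≤ q) :
    LocalBanachSpace q →L[𝕜] LocalBanachSpace p :=
  (UniformSpace.Completion.toComplL.comp (WithSeminorm.idMap h)).extend
    UniformSpace.Completion.toComplL

theorem canonicalMap_coe {p q : Seminorm 𝕜 E} (h : p ≤ q) (x : E) :
    canonicalMap h (WithSeminorm.of q x : LocalBanachSpace q) =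
      (WithSeminorm.of p x : LocalBanachSpace p) :=
  ContinuousLinearMap.extend_eq _ UniformSpace.Completion.denseRange_coe
    (UniformSpace.Completion.isUniformInducing_coe _) (WithSeminorm.of q x)

variable (𝕜 E) in
/-- A locally convex space `E` is nuclear if for every continuous seminorm `p` there is a
continuous seminorm `q ≥ p` such that the canonical map from the local Banach space at `q` to
the local Banach space at `p` is nuclear. -/
def IsNuclearSpace [TopologicalSpace E] [PolynormableSpace 𝕜 E] : Prop :=
  ∀ p : Seminorm 𝕜 E, Continuous p →
    ∃ q : Seminorm 𝕜 E, Continuous q ∧ ∃ h : p ≤ q, IsNuclearMap (canonicalMap h)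

end Nuclear

/-! ### Word length and growth of groups -/

section Groups

variable {G : Type*} [Group G]

/-- `S` is a finite symmetric set of generators of `G`. -/
structure IsGeneratingSet (S : Set G) : Prop where
  finite : S.Finite
  inv_mem : ∀ s ∈ S, s⁻¹ ∈ S
  closure_eq_top : Subgroup.closure S = ⊤

/-- The word length of `g`: the least number of elements of `S` with product `g`. -/
def wordLength (S : Set G) (g : G) : ℕ :=
  sInf {n : ℕ | ∃ l : List G, (∀ s ∈ l, s ∈ S) ∧ l.prod = g ∧ l.length = n}

/-- The volume growth: the number of elements of word length at most `n`. -/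
def volumeGrowth (S : Set G) (n : ℕ) : ℕ :=
  {g : G | wordLength S g ≤ n}.ncard

variable (G) in
/-- `G` is a finitely generated group of polynomial growth. -/
def HasPolynomialGrowth : Prop :=
  ∃ S : Set G, IsGeneratingSet S ∧
    ∃ (C : ℝ) (d : ℕ), ∀ n : ℕ, (volumeGrowth S n : ℝ) ≤ C * (1 + (n : ℝ)) ^ d

end Groups

/-! ### Growth functions -/

/-- A growth function: a monotonically increasing, unbounded map from `ℕ` to `[1, ∞)`. -/
structure GrowthFunction where
  /-- The underlying function. -/
  toFun : ℕ → ℝ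
  one_le : ∀ n, 1 ≤ toFun n
  mono : Monotone toFun
  unbounded : ¬ BddAbove (Set.range toFun)

instance : CoeFun GrowthFunction (fun _ => ℕ → ℝ) := ⟨GrowthFunction.toFun⟩

theorem eval_le_eval {P : Polynomial ℝ} (hP : ∀ i, 0 ≤ P.coeff i) {x y : ℝ} (hx : 0 ≤ x)
    (hxy : x ≤ y) : P.eval x ≤ P.eval y := by
  rw [Polynomial.eval_eq_sum_range, Polynomial.eval_eq_sum_range]
  gcongr with i
  exact hP i

theorem eval_tendsto {P : Polynomial ℝ} (hd : 1 ≤ P.natDegree) (hP : ∀ i, 0 ≤ P.coeff i) :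
    Filter.Tendsto (fun n : ℕ => P.eval (n : ℝ)) Filter.atTop Filter.atTop :=
  (P.tendsto_atTop_of_leadingCoeff_nonneg (Polynomial.natDegree_pos_iff_degree_pos.mp hd)
    (hP _)).comp tendsto_natCast_atTop_atTop

/-- A polynomial growth of degree `d ≥ 1`: the growth function `n ↦ a_d n^d + ⋯ + a_1 n + 1` with
coefficients `a_i ≥ 0` and `a_d > 0`. -/
def polynomialGrowth (P : Polynomial ℝ) (hd : 1 ≤ P.natDegree) (h0 : P.coeff 0 = 1)
    (hP : ∀ i, 0 ≤ P.coeff i) : GrowthFunction where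
  toFun n := P.eval (n : ℝ)
  one_le n := by
    have h := eval_le_eval hP le_rfl (Nat.cast_nonneg n)
    rwa [← Polynomial.coeff_zero_eq_eval_zero, h0] at h
  mono m n hmn := eval_le_eval hP (Nat.cast_nonneg m) (Nat.cast_le.mpr hmn)
  unbounded := Filter.not_bddAbove_of_tendsto_atTop (eval_tendsto hd hP)

/-! ### The space `𝒜_σ(G)` -/

section RapidAlgebra

variable {G : Type*} [Group G]

/-- The formal series `a = ∑ a_g e_g` with `∑ |a_g| σ(L(g))^R < ∞` for all `R ≥ 0`, where `L` is
the word length with respect to `S`. -/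
def rapidSubmodule (σ : GrowthFunction) (S : Set G) : Submodule ℂ (G → ℂ) where
  carrier := {a | ∀ R : ℝ≥0, Summable fun g => ‖a g‖ * σ (wordLength S g) ^ (R : ℝ)}
  zero_mem' R := by simp
  add_mem' {a b} ha hb R := by
    refine Summable.of_nonneg_of_le (fun g => ?_) (fun g => ?_) ((ha R).add (hb R))
    · exact mul_nonneg (norm_nonneg _) (Real.rpow_nonneg (zero_le_one.trans (σ.one_le _)) _)
    · rw [← add_mul]
      exact mul_le_mul_of_nonneg_right (norm_add_le _ _)
        (Real.rpow_nonneg (zero_le_one.trans (σ.one_le _)) _)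
  smul_mem' c a ha R := by
    simpa [mul_assoc] using (ha R).mul_left ‖c‖

/-- The space `𝒜_σ(G)`. This is a new type, since it does not carry the topology of pointwise
convergence but the one defined by the norms `rapidNorm` below. -/
def RapidAlgebra (σ : GrowthFunction) (S : Set G) : Type _ := rapidSubmodule σ S

namespace RapidAlgebra

variable (σ : GrowthFunction) (S : Set G)

instance : AddCommGroup (RapidAlgebra σ S) := inferInstanceAs (AddCommGroup (rapidSubmodule σ S))

instance : Module ℂ (RapidAlgebra σ S) := inferInstanceAs (Module ℂ (rapidSubmodule σ S))

variable {σ S} in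
/-- The coefficient `a_g` of `a`. -/
def coeff (a : RapidAlgebra σ S) (g : G) : ℂ := a.1 g

variable {σ S} in
theorem summable (a : RapidAlgebra σ S) (R : ℝ≥0) :
    Summable fun g => ‖a.coeff g‖ * σ (wordLength S g) ^ (R : ℝ) := a.2 R

/-- The norm `‖a‖_R = ∑ |a_g| σ(L(g))^R`. -/
def rapidNorm (R : ℝ≥0) : Seminorm ℂ (RapidAlgebra σ S) :=
  Seminorm.of (fun a => ∑' g, ‖a.coeff g‖ * σ (wordLength S g) ^ (R : ℝ))
    (fun a b => by
      rw [← (a.summable R).tsum_add (b.summable R)]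
      refine ((a + b).summable R).tsum_le_tsum (fun g => ?_) ((a.summable R).add (b.summable R))
      rw [← add_mul]
      exact mul_le_mul_of_nonneg_right (norm_add_le (a.coeff g) (b.coeff g))
        (Real.rpow_nonneg (zero_le_one.trans (σ.one_le _)) _))
    (fun c a => by
      rw [← tsum_mul_left]
      refine tsum_congr fun g => ?_
      rw [← mul_assoc, ← norm_mul]
      rfl)

/-- The locally convex topology defined by all the norms `‖·‖_R`, `R ≥ 0`. -/
instance : TopologicalSpace (RapidAlgebra σ S) :=
  (SeminormFamily.moduleFilterBasis (fun R : ℝ≥0 => rapidNorm σ S R)).topology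

theorem withSeminorms : WithSeminorms (fun R : ℝ≥0 => rapidNorm σ S R) := ⟨rfl⟩

instance : PolynormableSpace ℂ (RapidAlgebra σ S) := (withSeminorms σ S).toPolynormableSpace

end RapidAlgebra

end RapidAlgebra

end RapidDecay

end

/-! Both properties are equivalent to the summability of `σ(L(g))^(-R)` over `G` for some `R`.

If this sum converges for `R₀`, the canonical map from the completion at `‖·‖_{R+R₀}` to the one at
`‖·‖_R` is `a ↦ ∑ a_g e_g`. The functional `a ↦ a_g` has norm at most `σ(L(g))^(-R-R₀)` and `e_g`
has norm `σ(L(g))^R`, so the products of norms are summable (`isNuclearSpace_of_summable`).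

Conversely, apply nuclearity to the `ℓ¹` norm `‖·‖_0`. Reading the `g`-th coefficient of the
expansion `∑ f_n(e_g) y_n` of `e_g` gives `1 = ∑ f_n(e_g) (y_n)_g`, where `|f_n(e_g)| ≤ ‖f_n‖ C
σ(L(g))^R`. Divide by `σ(L(g))^R` and sum over `g`: since `∑_g |(y_n)_g| ≤ ‖y_n‖`, the total is at
most `C ∑ ‖f_n‖ ‖y_n‖` (`exists_sum_le_of_isNuclearSpace`).

Finally, `σ` lies between multiples of `1 + n` and `(1 + n)^d`, so such summability amounts to
polynomial growth of the balls. -/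

namespace RapidDecay

/-! ### Word length and growth -/

section WordLength

variable {G : Type*} [Group G] {S T : Set G}

theorem wordLength_le_length {l : List G} (hl : ∀ s ∈ l, s ∈ S) :
    wordLength S l.prod ≤ l.length :=
  Nat.sInf_le ⟨l, hl, rfl, rfl⟩

theorem IsGeneratingSet.exists_list (hS : IsGeneratingSet S) (g : G) :
    ∃ l : List G, (∀ s ∈ l, s ∈ S) ∧ l.prod = g ∧ l.length = wordLength S g := by
  have hg : g ∈ (Subgroup.closure S).toSubmonoid := by simp [hS.closure_eq_top]
  -- By symmetry the generated subgroup is the generated submonoid, so the infimum defining the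
  -- length is over a nonempty set.
  have hinv : S⁻¹ ⊆ S := fun s hs => by simpa using hS.inv_mem s⁻¹ hs
  rw [Subgroup.closure_toSubmonoid, Set.union_eq_self_of_subset_right hinv] at hg
  obtain ⟨l, hl, hprod⟩ := Submonoid.exists_list_of_mem_closure hg
  exact Nat.sInf_mem (s := {n | ∃ l : List G, (∀ s ∈ l, s ∈ S) ∧ l.prod = g ∧ l.length = n})
    ⟨l.length, l, hl, hprod, rfl⟩

theorem wordLength_one (S : Set G) : wordLength S 1 = 0 :=
  Nat.le_zero.mp (wordLength_le_length (S := S) (l := []) (by simp))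

theorem IsGeneratingSet.wordLength_mul_le (hS : IsGeneratingSet S) (g h : G) :
    wordLength S (g * h) ≤ wordLength S g + wordLength S h := by
  obtain ⟨l, hl, rfl, hlen⟩ := hS.exists_list g
  obtain ⟨m, hm, rfl, hmlen⟩ := hS.exists_list h
  rw [← hlen, ← hmlen, ← List.prod_append, ← List.length_append]
  exact wordLength_le_length fun s hs => (List.mem_append.mp hs).elim (hl s) (hm s)

theorem IsGeneratingSet.finite_ball (hS : IsGeneratingSet S) (n : ℕ) :
    {g : G | wordLength S g ≤ n}.Finite := by
  have : Finite S := hS.finite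
  refine ((List.finite_length_le S n).image fun l => (l.map Subtype.val).prod).subset ?_
  intro g hg
  obtain ⟨l, hl, hprod, hlen⟩ := hS.exists_list g
  lift l to List S using hl
  refine ⟨l, ?_, hprod⟩
  rw [List.length_map] at hlen
  exact hlen.trans_le hg

theorem IsGeneratingSet.countable (hS : IsGeneratingSet S) : Countable G := by
  rw [← Set.countable_univ_iff]
  refine (Set.countable_iUnion fun n => (hS.finite_ball n).countable).mono fun g _ => ?_
  exact Set.mem_iUnion.mpr ⟨wordLength S g, le_refl (wordLength S g)⟩

/-- Take for `M` a bound of the `T`-length on the finite set `S` and replace each letter of a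
shortest `S`-word by a `T`-word. -/
theorem IsGeneratingSet.exists_wordLength_le_mul (hS : IsGeneratingSet S)
    (hT : IsGeneratingSet T) : ∃ M : ℕ, ∀ g, wordLength T g ≤ M * wordLength S g := by
  obtain ⟨M, hM⟩ := (hS.finite.image (wordLength T)).bddAbove
  refine ⟨M, fun g => ?_⟩
  obtain ⟨l, hl, rfl, hlen⟩ := hS.exists_list g
  rw [← hlen]
  clear hlen
  induction l with
  | nil => simp [wordLength_one]
  | cons s l ih =>
    rw [List.forall_mem_cons] at hl
    rw [List.prod_cons, List.length_cons, mul_add, mul_one, add_comm]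
    exact (hT.wordLength_mul_le _ _).trans
      (add_le_add (hM (Set.mem_image_of_mem _ hl.1)) (ih hl.2))

/-- Polynomial growth does not depend on the generating set. -/
theorem HasPolynomialGrowth.exists_volumeGrowth_le (hG : HasPolynomialGrowth G)
    (hS : IsGeneratingSet S) :
    ∃ (C : ℝ) (d : ℕ), ∀ n : ℕ, (volumeGrowth S n : ℝ) ≤ C * (1 + (n : ℝ)) ^ d := by
  obtain ⟨T, hT, C, d, hC⟩ := hG
  obtain ⟨M, hM⟩ := hS.exists_wordLength_le_mul hT
  have hC0 : 0 ≤ C := by simpa using (Nat.cast_nonneg _).trans (hC 0)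
  refine ⟨C * (1 + M) ^ d, d, fun n => ?_⟩
  have hsub : volumeGrowth S n ≤ volumeGrowth T (M * n) :=
    Set.ncard_le_ncard (fun g hg => (hM g).trans (Nat.mul_le_mul_left M hg))
      (hT.finite_ball _)
  calc (volumeGrowth S n : ℝ) ≤ volumeGrowth T (M * n) := by exact_mod_cast hsub
    _ ≤ C * (1 + ((M * n : ℕ) : ℝ)) ^ d := hC _
    _ ≤ C * ((1 + M) * (1 + n)) ^ d := by
        gcongr
        push_cast
        nlinarith [Nat.cast_nonneg (α := ℝ) M, Nat.cast_nonneg (α := ℝ) n]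
    _ = C * (1 + M) ^ d * (1 + n) ^ d := by rw [mul_pow, mul_assoc]

theorem HasPolynomialGrowth.summable_wordLength (hG : HasPolynomialGrowth G)
    (hS : IsGeneratingSet S) :
    ∃ k : ℕ, Summable fun g : G => ((1 + (wordLength S g : ℝ)) ^ k)⁻¹ := by
  obtain ⟨C, d, hC⟩ := hG.exists_volumeGrowth_le hS
  -- At most `C (1 + n)^d` elements have length exactly `n`; the two extra powers leave the
  -- convergent series `∑ C / (n + 1)^2`.
  refine ⟨d + 2, ?_⟩
  have hfin (n : ℕ) : Finite {g : G // wordLength S g = n} :=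
    (hS.finite_ball n).subset fun g (hg : wordLength S g = n) => hg.le
  rw [← (Equiv.sigmaFiberEquiv (wordLength S)).summable_iff,
    summable_sigma_of_nonneg fun x => by simp only [Function.comp_apply]; positivity]
  refine ⟨fun n => .of_finite, ?_⟩
  have hsum : Summable fun n : ℕ => C * (1 / ((n + 1 : ℕ) : ℝ) ^ 2) :=
    ((summable_nat_add_iff 1).mpr (Real.summable_one_div_nat_pow.mpr one_lt_two)).mul_left C
  refine hsum.of_nonneg_of_le (fun n => tsum_nonneg fun y => by
    simp only [Function.comp_apply]; positivity) fun n => ?_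
  have hcard : (Nat.card {g : G // wordLength S g = n} : ℝ) ≤ C * (1 + n) ^ d := by
    refine le_trans ?_ (hC n)
    exact_mod_cast Set.ncard_le_ncard (fun g (hg : wordLength S g = n) => hg.le)
      (hS.finite_ball n)
  have hterm (y : {g : G // wordLength S g = n}) :
      ((fun g : G => ((1 + (wordLength S g : ℝ)) ^ (d + 2))⁻¹) ∘
        Equiv.sigmaFiberEquiv (wordLength S)) ⟨n, y⟩ = ((1 + (n : ℝ)) ^ (d + 2))⁻¹ := by
    simp [Equiv.sigmaFiberEquiv, y.2]
  rw [tsum_congr hterm, tsum_const, nsmul_eq_mul]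
  calc _ ≤ C * (1 + n) ^ d * ((1 + (n : ℝ)) ^ (d + 2))⁻¹ := by gcongr
    _ = C * (1 / ((n + 1 : ℕ) : ℝ) ^ 2) := by
      push_cast
      field_simp
      ring

end WordLength

/-! ### Comparison of polynomial growth functions with powers -/

section PolynomialGrowth

variable {P : Polynomial ℝ} (hd : 1 ≤ P.natDegree) (h0 : P.coeff 0 = 1) (hP : ∀ i, 0 ≤ P.coeff i)

/-- The constant term bounds `1` and, as `n ≤ n ^ d` for `d ≥ 1`, the leading term bounds `a_d n`.
-/
theorem exists_mul_le_polynomialGrowth :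
    ∃ c : ℝ, 0 < c ∧ ∀ n : ℕ, c * (1 + (n : ℝ)) ≤ polynomialGrowth P hd h0 hP n := by
  have hlead : 0 < P.coeff P.natDegree := (hP _).lt_of_ne' fun h => by
    rw [Polynomial.coeff_natDegree, Polynomial.leadingCoeff_eq_zero] at h
    simp [h] at hd
  refine ⟨min 1 (P.coeff P.natDegree), lt_min one_pos hlead, fun n => ?_⟩
  have hpow : (n : ℝ) ≤ (n : ℝ) ^ P.natDegree := by
    exact_mod_cast Nat.le_self_pow (by omega) n
  have hconst : 1 ≤ ∑ i ∈ Finset.range P.natDegree, P.coeff i * (n : ℝ) ^ i := by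
    have h := Finset.single_le_sum (f := fun i => P.coeff i * (n : ℝ) ^ i)
      (fun i _ => mul_nonneg (hP i) (by positivity)) (Finset.mem_range.mpr hd)
    simpa [h0] using h
  change _ ≤ P.eval (n : ℝ)
  rw [Polynomial.eval_eq_sum_range, Finset.sum_range_succ, mul_add, mul_one]
  refine add_le_add ((min_le_left _ _).trans hconst) ?_
  exact mul_le_mul (min_le_right _ _) hpow (Nat.cast_nonneg n) hlead.le

theorem exists_polynomialGrowth_le :
    ∃ A : ℝ, 0 ≤ A ∧
      ∀ n : ℕ, polynomialGrowth P hd h0 hP n ≤ A * (1 + (n : ℝ)) ^ P.natDegree := by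
  refine ⟨∑ i ∈ Finset.range (P.natDegree + 1), P.coeff i, Finset.sum_nonneg fun i _ => hP i,
    fun n => ?_⟩
  change P.eval (n : ℝ) ≤ _
  rw [Polynomial.eval_eq_sum_range, Finset.sum_mul]
  refine Finset.sum_le_sum fun i hi => mul_le_mul_of_nonneg_left ?_ (hP i)
  have hn : (0 : ℝ) ≤ n := Nat.cast_nonneg n
  calc (n : ℝ) ^ i ≤ (1 + n) ^ i := by gcongr; linarith
    _ ≤ (1 + n) ^ P.natDegree :=
      pow_le_pow_right₀ (by linarith) (Nat.lt_succ_iff.mp (Finset.mem_range.mp hi))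

end PolynomialGrowth

/-! ### Local Banach spaces and nuclear maps -/

section LocalBanachSpace

variable {𝕜 : Type*} [RCLike 𝕜] {E : Type*} [AddCommGroup E] [Module 𝕜 E]

namespace LocalBanachSpace

/-- The continuous extension to the local Banach space at `p` of a linear functional on `E` that
is bounded by `C * p`. -/
noncomputable def lift (p : Seminorm 𝕜 E) (φ : E →ₗ[𝕜] 𝕜) (C : ℝ) (h : ∀ x, ‖φ x‖ ≤ C * p x) :
    LocalBanachSpace p →L[𝕜] 𝕜 :=
  (LinearMap.mkContinuous
    ({ toFun := fun x => φ (show E from x)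
       map_add' := map_add φ
       map_smul' := map_smul φ } : WithSeminorm p →ₗ[𝕜] 𝕜) C h).extend
    UniformSpace.Completion.toComplL

theorem lift_coe (p : Seminorm 𝕜 E) (φ : E →ₗ[𝕜] 𝕜) (C : ℝ) (h : ∀ x, ‖φ x‖ ≤ C * p x) (x : E) :
    lift p φ C h (WithSeminorm.of p x : LocalBanachSpace p) = φ x :=
  ContinuousLinearMap.extend_eq _ UniformSpace.Completion.denseRange_coe
    (UniformSpace.Completion.isUniformInducing_coe _) (WithSeminorm.of p x)

theorem norm_coe_of (p : Seminorm 𝕜 E) (x : E) :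
    ‖(WithSeminorm.of p x : LocalBanachSpace p)‖ = p x :=
  UniformSpace.Completion.norm_coe _

theorem induction_on {p : Seminorm 𝕜 E} {motive : LocalBanachSpace p → Prop}
    (x : LocalBanachSpace p) (hclosed : IsClosed {x | motive x})
    (hcoe : ∀ x : E, motive (WithSeminorm.of p x : LocalBanachSpace p)) : motive x :=
  UniformSpace.Completion.induction_on x hclosed hcoe

theorem norm_lift_le (p : Seminorm 𝕜 E) (φ : E →ₗ[𝕜] 𝕜) (C : ℝ) (h : ∀ x, ‖φ x‖ ≤ C * p x)
    (hC : 0 ≤ C) : ‖lift p φ C h‖ ≤ C := by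
  refine ContinuousLinearMap.opNorm_le_bound _ hC fun x => ?_
  induction x using induction_on with
  | hclosed => exact isClosed_le (by fun_prop) (by fun_prop)
  | hcoe x => rw [lift_coe, norm_coe_of]; exact h x

end LocalBanachSpace

/-- To show that a map is nuclear, one may use expansions indexed by any countable type, and it
suffices to check the expansion on a dense subset. -/
theorem isNuclearMap_of_countable {ι X Y : Type*} [Countable ι] [SeminormedAddCommGroup X]
    [NormedSpace 𝕜 X] [NormedAddCommGroup Y] [NormedSpace 𝕜 Y] [CompleteSpace Y] (T : X →L[𝕜] Y)
    (f : ι → X →L[𝕜] 𝕜) (y : ι → Y) (hsum : Summable fun i => ‖f i‖ * ‖y i‖) {s : Set X}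
    (hs : Dense s) (hT : ∀ x ∈ s, HasSum (fun i => f i x • y i) (T x)) : IsNuclearMap T := by
  have hsumm : Summable fun i => (f i).smulRight (y i) :=
    Summable.of_norm (by simpa only [ContinuousLinearMap.norm_smulRight_apply] using hsum)
  have hexp (x : X) : HasSum (fun i => f i x • y i) ((∑' i, (f i).smulRight (y i)) x) :=
    hsumm.hasSum.mapL (ContinuousLinearMap.apply 𝕜 Y x)
  -- Two continuous maps that agree on the dense set `s`.
  have hTeq : T = ∑' i, (f i).smulRight (y i) :=
    ContinuousLinearMap.ext fun x => congrFun
      (Continuous.ext_on hs (map_continuous _) (map_continuous _)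
        fun x hx => (hT x hx).unique (hexp x)) x
  -- Reindex by `ℕ` along an injection, with zero terms off its range.
  obtain ⟨e, he⟩ := exists_injective_nat ι
  refine ⟨Function.extend e f 0, Function.extend e y 0, ?_, fun x => ?_⟩
  · have h : (fun n => ‖Function.extend e f 0 n‖ * ‖Function.extend e y 0 n‖) =
        Function.extend e (fun i => ‖f i‖ * ‖y i‖) 0 := by
      funext n
      by_cases hn : ∃ i, e i = n
      · obtain ⟨i, rfl⟩ := hn
        simp only [he.extend_apply]
      · simp [Function.extend_apply' _ _ _ hn]
    rw [h]
    exact ((hasSum_extend_zero he).mpr hsum.hasSum).summable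
  · have h : (fun n => Function.extend e f 0 n x • Function.extend e y 0 n) =
        Function.extend e (fun i => f i x • y i) 0 := by
      funext n
      by_cases hn : ∃ i, e i = n
      · obtain ⟨i, rfl⟩ := hn
        simp only [he.extend_apply]
      · simp [Function.extend_apply' _ _ _ hn]
    rw [h, hasSum_extend_zero he, hTeq]
    exact hexp x

end LocalBanachSpace

/-! ### Nuclearity of `𝒜_σ(G)` -/

namespace RapidAlgebra

variable {G : Type*} [Group G] {σ : GrowthFunction} {S : Set G}

theorem _root_.RapidDecay.GrowthFunction.pos (σ : GrowthFunction) (n : ℕ) : 0 < σ n :=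
  one_pos.trans_le (σ.one_le n)

theorem rapidNorm_apply (R : ℝ≥0) (a : RapidAlgebra σ S) :
    rapidNorm σ S R a = ∑' g, ‖a.coeff g‖ * σ (wordLength S g) ^ (R : ℝ) :=
  rfl

/-- The coefficient at `g` as a linear functional. -/
def coeffₗ (σ : GrowthFunction) (S : Set G) (g : G) : RapidAlgebra σ S →ₗ[ℂ] ℂ where
  toFun a := a.coeff g
  map_add' _ _ := rfl
  map_smul' _ _ := rfl

theorem coeffₗ_apply (g : G) (a : RapidAlgebra σ S) : coeffₗ σ S g a = a.coeff g := rfl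

open Classical in
/-- The basis vector `e_g`. -/
noncomputable def single (σ : GrowthFunction) (S : Set G) (g : G) : RapidAlgebra σ S :=
  ⟨Pi.single g 1, fun R => (hasSum_single g fun h hh => by
    simp [Pi.single_eq_of_ne hh]).summable⟩

theorem coeff_single_self (g : G) : (single σ S g).coeff g = 1 :=
  by classical exact Pi.single_eq_same (M := fun _ => ℂ) g 1

theorem coeff_single_of_ne {g h : G} (hne : h ≠ g) : (single σ S g).coeff h = 0 :=
  by classical exact Pi.single_eq_of_ne (M := fun _ => ℂ) hne 1

theorem rapidNorm_single (R : ℝ≥0) (g : G) :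
    rapidNorm σ S R (single σ S g) = σ (wordLength S g) ^ (R : ℝ) := by
  rw [rapidNorm_apply, tsum_eq_single g fun h hh => by simp [coeff_single_of_ne hh]]
  simp [coeff_single_self]

theorem rapidNorm_mono {R R' : ℝ≥0} (h : R ≤ R') : rapidNorm σ S R ≤ rapidNorm σ S R' :=
  fun a => (a.summable R).tsum_le_tsum (fun _ => mul_le_mul_of_nonneg_left
    (Real.rpow_le_rpow_of_exponent_le (σ.one_le _) h) (norm_nonneg _)) (a.summable R')

theorem norm_coeff_mul_le_rapidNorm (R : ℝ≥0) (a : RapidAlgebra σ S) (g : G) :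
    ‖a.coeff g‖ * σ (wordLength S g) ^ (R : ℝ) ≤ rapidNorm σ S R a :=
  (a.summable R).le_tsum g fun _ _ =>
    mul_nonneg (norm_nonneg _) (Real.rpow_nonneg (σ.pos _).le _)

/-- The norms increase with `R` because `σ ≥ 1`, so a finite supremum of them is bounded by the one
with the largest exponent. -/
theorem exists_le_smul_rapidNorm (p : Seminorm ℂ (RapidAlgebra σ S)) (hp : Continuous p) :
    ∃ (R : ℝ≥0) (C : ℝ≥0), 0 < C ∧ p ≤ C • rapidNorm σ S R := by
  obtain ⟨s, C, hC, h⟩ := Seminorm.bound_of_continuous (withSeminorms σ S) p hp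
  refine ⟨s.sup id, C, pos_iff_ne_zero.mpr hC, h.trans fun a => ?_⟩
  refine mul_le_mul_of_nonneg_left ?_ C.2
  exact Seminorm.finset_sup_apply_le (apply_nonneg _ _) fun R hR =>
    rapidNorm_mono (Finset.le_sup (f := id) hR) a

theorem coeff_sub (a b : RapidAlgebra σ S) (g : G) : (a - b).coeff g = a.coeff g - b.coeff g := rfl

theorem coeff_sum_single (F : Finset G) (a : RapidAlgebra σ S) (h : G) [Decidable (h ∈ F)] :
    (∑ g ∈ F, a.coeff g • single σ S g).coeff h = if h ∈ F then a.coeff h else 0 := by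
  have hterm (g : G) : coeffₗ σ S h (a.coeff g • single σ S g) =
      a.coeff g * (single σ S g).coeff h := rfl
  rw [← coeffₗ_apply, map_sum]
  simp_rw [hterm]
  split_ifs with hF
  · rw [Finset.sum_eq_single_of_mem h hF fun g _ hg => by rw [coeff_single_of_ne hg.symm, mul_zero],
      coeff_single_self, mul_one]
  · exact Finset.sum_eq_zero fun g hg => by
      rw [coeff_single_of_ne (ne_of_mem_of_not_mem hg hF).symm, mul_zero]

/-- The expansion of `a` in the basis `e_g` converges in each local Banach space. -/
theorem hasSum_single (p : Seminorm ℂ (RapidAlgebra σ S)) (hp : Continuous p)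
    (a : RapidAlgebra σ S) :
    HasSum (fun g => a.coeff g • (WithSeminorm.of p (single σ S g) : LocalBanachSpace p))
      (WithSeminorm.of p a : LocalBanachSpace p) := by
  classical
  obtain ⟨R, C, -, hle⟩ := exists_le_smul_rapidNorm p hp
  let j : RapidAlgebra σ S →ₗ[ℂ] LocalBanachSpace p :=
    (UniformSpace.Completion.toComplL (𝕜 := ℂ) (E := WithSeminorm p)).toLinearMap ∘ₗ
      WithSeminorm.of p
  have hj (x : RapidAlgebra σ S) : ‖j x‖ = p x := LocalBanachSpace.norm_coe_of p x
  change HasSum (fun g => a.coeff g • j (single σ S g)) (j a)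
  rw [HasSum, tendsto_iff_norm_sub_tendsto_zero]
  -- The error of the partial sum over `F` is at most `C` times the part of the norm series outside
  -- `F`.
  have htail := (tendsto_tsum_compl_atTop_zero
    fun g => ‖a.coeff g‖ * σ (wordLength S g) ^ (R : ℝ)).const_mul (C : ℝ)
  rw [mul_zero] at htail
  refine squeeze_zero (fun _ => norm_nonneg _) (fun F => ?_) htail
  rw [norm_sub_rev]
  simp_rw [← map_smul, ← map_sum, ← map_sub, hj]
  refine (hle _).trans (mul_le_mul_of_nonneg_left ?_ C.2)
  rw [rapidNorm_apply]
  refine le_of_eq ?_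
  rw [← tsum_subtype_eq_of_support_subset (s := {g | g ∉ F})]
  · refine tsum_congr fun g => ?_
    rw [coeff_sub, coeff_sum_single, if_neg g.2, sub_zero]
  · intro g hg hF
    refine hg ?_
    simp [coeff_sub, coeff_sum_single, hF]

/-- If some negative power of `σ ∘ L` is summable, then `𝒜_σ(G)` is nuclear. -/
theorem isNuclearSpace_of_summable [Countable G] (R₀ : ℝ≥0)
    (hR₀ : Summable fun g : G => (σ (wordLength S g) ^ (R₀ : ℝ))⁻¹) :
    IsNuclearSpace ℂ (RapidAlgebra σ S) := by
  intro p hp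
  obtain ⟨R, C, hC, hle⟩ := exists_le_smul_rapidNorm p hp
  -- Raising the exponent by `R₀` makes the summands at most `σ(L(g))^(-R₀)`; the factor `C` gives
  -- `p ≤ q` and cancels in the product of norms.
  let q : Seminorm ℂ (RapidAlgebra σ S) := C • rapidNorm σ S (R + R₀)
  have hpq : p ≤ q := hle.trans fun a =>
    mul_le_mul_of_nonneg_left (rapidNorm_mono (le_add_of_nonneg_right R₀.2) a) C.2
  have hq : Continuous q := ((withSeminorms σ S).continuous_seminorm (R + R₀)).const_smul C
  have hbound (g : G) (a : RapidAlgebra σ S) : ‖coeffₗ σ S g a‖ ≤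
      (C * σ (wordLength S g) ^ ((R + R₀ : ℝ≥0) : ℝ))⁻¹ * q a := by
    have hpos : 0 < (C : ℝ) * σ (wordLength S g) ^ ((R + R₀ : ℝ≥0) : ℝ) :=
      mul_pos hC (Real.rpow_pos_of_pos (σ.pos _) _)
    rw [inv_mul_eq_div, le_div_iff₀ hpos, mul_left_comm]
    exact mul_le_mul_of_nonneg_left (norm_coeff_mul_le_rapidNorm _ a g) C.2
  have hpos (g : G) (R : ℝ≥0) := Real.rpow_pos_of_pos (σ.pos (wordLength S g)) R
  refine ⟨q, hq, hpq, isNuclearMap_of_countable _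
    (fun g => LocalBanachSpace.lift q (coeffₗ σ S g) _ (hbound g))
    (fun g => (WithSeminorm.of p (single σ S g) : LocalBanachSpace p)) ?_
    UniformSpace.Completion.denseRange_coe ?_⟩
  · refine hR₀.of_nonneg_of_le (fun g => by positivity) fun g => ?_
    have hC' : 0 < (C : ℝ) := hC
    have h1 := LocalBanachSpace.norm_lift_le q (coeffₗ σ S g) _ (hbound g)
      (inv_nonneg.mpr (mul_pos hC' (hpos g _)).le)
    have h2 : ‖(WithSeminorm.of p (single σ S g) : LocalBanachSpace p)‖ ≤
        C * σ (wordLength S g) ^ (R : ℝ) := by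
      rw [LocalBanachSpace.norm_coe_of, ← rapidNorm_single]
      exact hle _
    refine (mul_le_mul h1 h2 (norm_nonneg _) ((norm_nonneg _).trans h1)).trans_eq ?_
    have := hpos g R
    rw [NNReal.coe_add, Real.rpow_add (σ.pos _)]
    field_simp
  · rintro _ ⟨x, rfl⟩
    have hexp (a : RapidAlgebra σ S) : HasSum
        (fun g => LocalBanachSpace.lift q (coeffₗ σ S g) _ (hbound g)
          (WithSeminorm.of q a : LocalBanachSpace q) •
            (WithSeminorm.of p (single σ S g) : LocalBanachSpace p))
        (canonicalMap hpq (WithSeminorm.of q a : LocalBanachSpace q)) := by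
      simp_rw [LocalBanachSpace.lift_coe, canonicalMap_coe, coeffₗ_apply]
      exact hasSum_single p hp a
    exact hexp x

/-- If `𝒜_σ(G)` is nuclear, then the finite sums of some negative power of `σ ∘ L` are bounded. -/
theorem exists_sum_le_of_isNuclearSpace (h : IsNuclearSpace ℂ (RapidAlgebra σ S)) :
    ∃ (M : ℝ) (R : ℝ≥0), ∀ F : Finset G, ∑ g ∈ F, (σ (wordLength S g) ^ (R : ℝ))⁻¹ ≤ M := by
  set p := rapidNorm σ S 0 with hpdef
  obtain ⟨q, hq, hpq, f, y, hsum, hT⟩ := h p ((withSeminorms σ S).continuous_seminorm 0)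
  obtain ⟨R, C, hC, hle⟩ := exists_le_smul_rapidNorm q hq
  have hp (a : RapidAlgebra σ S) : p a = ∑' g, ‖a.coeff g‖ := by simp [hpdef, rapidNorm_apply]
  have hsummable (a : RapidAlgebra σ S) : Summable fun g => ‖a.coeff g‖ := by
    simpa using a.summable 0
  have hbound (g : G) (a : RapidAlgebra σ S) : ‖coeffₗ σ S g a‖ ≤ 1 * p a := by
    rw [one_mul, hp]
    exact (hsummable a).le_tsum g fun _ _ => norm_nonneg _
  let δ (g : G) := LocalBanachSpace.lift p (coeffₗ σ S g) 1 (hbound g)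
  -- The `ℓ¹` estimate passes from `𝒜_σ(G)` to its completion by density.
  have hδ (F : Finset G) (z : LocalBanachSpace p) : ∑ g ∈ F, ‖δ g z‖ ≤ ‖z‖ := by
    induction z using LocalBanachSpace.induction_on with
    | hclosed => exact isClosed_le (by fun_prop) (by fun_prop)
    | hcoe a =>
      simp_rw [δ, LocalBanachSpace.lift_coe, LocalBanachSpace.norm_coe_of, hp]
      exact (hsummable a).sum_le_tsum F fun _ _ => norm_nonneg _
  refine ⟨C * ∑' n, ‖f n‖ * ‖y n‖, R, fun F => ?_⟩
  have hf (n : ℕ) (g : G) : ‖f n (WithSeminorm.of q (single σ S g) : LocalBanachSpace q)‖ ≤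
      ‖f n‖ * (C * σ (wordLength S g) ^ (R : ℝ)) := by
    refine (f n).le_opNorm_of_le ?_
    rw [LocalBanachSpace.norm_coe_of, ← rapidNorm_single]
    exact hle _
  have hterm (g : G) (n : ℕ) : ‖δ g (y n)‖ * ‖f n‖ ≤ ‖f n‖ * ‖y n‖ := by
    rw [mul_comm]
    gcongr
    simpa using hδ {g} (y n)
  have hsumg (g : G) : Summable fun n => ‖δ g (y n)‖ * ‖f n‖ :=
    hsum.of_nonneg_of_le (fun n => by positivity) (hterm g)
  have hg (g : G) : (σ (wordLength S g) ^ (R : ℝ))⁻¹ ≤ C * ∑' n, ‖δ g (y n)‖ * ‖f n‖ := by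
    have hpos := Real.rpow_pos_of_pos (σ.pos (wordLength S g)) (R : ℝ)
    -- The `g`-th coefficient of the expansion of `e_g`, whose sum is `1`.
    have h1 := (hT (WithSeminorm.of q (single σ S g) : LocalBanachSpace q)).mapL (δ g)
    rw [canonicalMap_coe, LocalBanachSpace.lift_coe, coeffₗ_apply, coeff_single_self] at h1
    rw [inv_le_iff_one_le_mul₀ hpos]
    have hle' (n : ℕ) : ‖δ g (f n (WithSeminorm.of q (single σ S g) : LocalBanachSpace q) • y n)‖ ≤
        (C * σ (wordLength S g) ^ (R : ℝ)) * (‖δ g (y n)‖ * ‖f n‖) := by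
      rw [map_smul, norm_smul]
      refine (mul_le_mul_of_nonneg_right (hf n g) (norm_nonneg _)).trans_eq ?_
      ring
    have h2 := tsum_of_norm_bounded ((hsumg g).hasSum.mul_left _) hle'
    rw [h1.tsum_eq, norm_one] at h2
    linarith
  calc ∑ g ∈ F, (σ (wordLength S g) ^ (R : ℝ))⁻¹
      ≤ ∑ g ∈ F, C * ∑' n, ‖δ g (y n)‖ * ‖f n‖ := Finset.sum_le_sum fun g _ => hg g
    _ = C * ∑' n, ∑ g ∈ F, ‖δ g (y n)‖ * ‖f n‖ := by
      rw [← Finset.mul_sum, Summable.tsum_finsetSum fun g _ => hsumg g]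
    _ ≤ C * ∑' n, ‖f n‖ * ‖y n‖ := by
      refine mul_le_mul_of_nonneg_left ?_ C.2
      refine (summable_sum fun g _ => hsumg g).tsum_le_tsum (fun n => ?_) hsum
      rw [← Finset.sum_mul, mul_comm]
      exact mul_le_mul_of_nonneg_left (hδ F (y n)) (norm_nonneg _)

end RapidAlgebra

end RapidDecay

theorem mainTheorem12 {G : Type*} [Group G] (S : Set G) (hS : RapidDecay.IsGeneratingSet S)
    (P : Polynomial ℝ) (hd : 1 ≤ P.natDegree) (h0 : P.coeff 0 = 1) (hP : ∀ i, 0 ≤ P.coeff i) :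
    RapidDecay.IsNuclearSpace ℂ
        (RapidDecay.RapidAlgebra (RapidDecay.polynomialGrowth P hd h0 hP) S) ↔
      RapidDecay.HasPolynomialGrowth G := by
  constructor
  · intro h
    obtain ⟨M, R, hM⟩ := RapidDecay.RapidAlgebra.exists_sum_le_of_isNuclearSpace h
    obtain ⟨A, hA, hσ⟩ := RapidDecay.exists_polynomialGrowth_le hd h0 hP
    set σ := RapidDecay.polynomialGrowth P hd h0 hP
    obtain ⟨r, hr⟩ := exists_nat_ge R
    -- Each of the elements of the ball of radius `n` contributes at least `σ(n)^(-R)` to a sum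
    -- bounded by `M`, so the volume is at most `M σ(n)^R ≤ M (A (1 + n)^d)^r`.
    refine ⟨S, hS, M * A ^ r, P.natDegree * r, fun n => ?_⟩
    have hM0 : 0 ≤ M := by simpa using hM ∅
    have hpos := Real.rpow_pos_of_pos (σ.pos n) (R : ℝ)
    have hcard : (RapidDecay.volumeGrowth S n : ℝ) * (σ n ^ (R : ℝ))⁻¹ ≤ M := by
      refine le_trans ?_ (hM (hS.finite_ball n).toFinset)
      rw [RapidDecay.volumeGrowth, Set.ncard_eq_toFinset_card _ (hS.finite_ball n), ← nsmul_eq_mul]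
      refine Finset.card_nsmul_le_sum _ _ _ fun g hg => ?_
      have hg' : RapidDecay.wordLength S g ≤ n := by simpa using hg
      exact inv_anti₀ (Real.rpow_pos_of_pos (σ.pos _) _)
        (Real.rpow_le_rpow (σ.pos _).le (σ.mono hg') R.2)
    rw [← div_eq_mul_inv, div_le_iff₀ hpos] at hcard
    refine hcard.trans ?_
    rw [mul_assoc, pow_mul, ← mul_pow]
    refine mul_le_mul_of_nonneg_left ?_ hM0
    calc σ n ^ (R : ℝ) ≤ σ n ^ (r : ℝ) :=
          Real.rpow_le_rpow_of_exponent_le (σ.one_le n) (by exact_mod_cast hr)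
      _ = σ n ^ r := Real.rpow_natCast _ _
      _ ≤ _ := pow_le_pow_left₀ (σ.pos n).le (hσ n) r
  · intro h
    have := hS.countable
    obtain ⟨k, hk⟩ := h.summable_wordLength hS
    obtain ⟨c, hc, hσ⟩ := RapidDecay.exists_mul_le_polynomialGrowth hd h0 hP
    -- From `c (1 + L) ≤ σ(L)` follows `σ(L)^(-k) ≤ c^(-k) (1 + L)^(-k)`.
    refine RapidDecay.RapidAlgebra.isNuclearSpace_of_summable (k : ℝ≥0) ?_
    refine (hk.mul_left (c ^ k)⁻¹).of_nonneg_of_le (fun g => ?_) fun g => ?_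
    · exact inv_nonneg.mpr (Real.rpow_nonneg (RapidDecay.GrowthFunction.pos _ _).le _)
    · rw [NNReal.coe_natCast, Real.rpow_natCast, ← mul_inv, ← mul_pow]
      exact inv_anti₀ (by positivity) (pow_le_pow_left₀ (by positivity) (hσ _) k)
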